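/- All matroids are finite (empty ground sets are allowed), and $M(S)$ denotes a matroid $M$ with ground set $S$. Let $\rho_M$ be the rank function of $M$, and for $A\subseteq S$ let $\lambda_M(A)=\rho_M(S)-\rho_M(A)$ be the rank-lack and $\nu_M(A)=|A|-\rho_M(A)$ the nullity of $A$ in $M$. The free product of $M(S)$ and $N(T)$ is the matroid $M\mathbin{\Box}N$ on the disjoint union $S+T$ whose independent sets are the sets $A\subseteq S+T$ such that $A\cap S$ is independent in $M$ and $\lambda_M(A\cap S)\ge \nu_N(A\cap T)$. Two matroids are isomorphic, written $\cong$, if there is a bijection between their ground sets under which the independent sets correspond. Theorem. Let $M(S)$, $N(T)$, $P(U)$, $Q(V)$ be matroids such that $M\mathbin{\Box}N\cong P\mathbin{\Box}Q$ and $|S|=|U|$. Then $M\cong P$ and $N\cong Q$. -/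

import Mathlib

namespace Matroid

/-- The rank `ρ_M(A)` as a natural number (for finite matroids, where it is finite). -/
noncomputable def rk {α : Type*} (M : Matroid α) (A : Set α) : ℕ :=
  (M.eRk A).toNat

/-- The rank-lack `λ_M(A) = ρ(M) - ρ_M(A)`, where `ρ(M) = ρ_M(M.E)`. -/
noncomputable def rankLack {α : Type*} (M : Matroid α) (A : Set α) : ℤ :=
  (M.rk M.E : ℤ) - M.rk A

/-- The nullity `ν_M(A) = |A| - ρ_M(A)`. -/
noncomputable def nullity {α : Type*} (M : Matroid α) (A : Set α) : ℤ :=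
  (A.ncard : ℤ) - M.rk A

theorem coe_rk {α : Type*} (M : Matroid α) [M.Finite] (A : Set α) :
    ((M.rk A : ℕ) : ℕ∞) = M.eRk A := by
  refine ENat.natCast_toNat ?_
  have h1 : M.eRk A ≤ M.E.encard := (M.eRk_le_eRank A).trans M.eRank_le_encard_ground
  exact ne_top_of_le_ne_top (Set.encard_ne_top_iff.2 M.ground_finite) h1

theorem Indep.rk_eq {α : Type*} {M : Matroid α} {I : Set α} (hI : M.Indep I) :
    M.rk I = I.ncard := by
  unfold rk Set.ncard
  rw [hI.eRk_eq_encard]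

theorem rk_mono {α : Type*} (M : Matroid α) [M.Finite] {A B : Set α} (h : A ⊆ B) :
    M.rk A ≤ M.rk B := by
  rw [← Nat.cast_le (α := ℕ∞), coe_rk, coe_rk]
  exact M.eRk_mono h

theorem exists_rk_insert {α : Type*} (M : Matroid α) [M.Finite] {A B : Set α}
    (h : M.rk A < M.rk B) : ∃ y ∈ B \ A, M.rk (insert y A) = M.rk A + 1 := by
  rw [← Nat.cast_lt (α := ℕ∞), coe_rk, coe_rk] at h
  obtain ⟨y, hy, h2⟩ := M.exists_eRk_insert_eq_add_one_of_lt h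
  refine ⟨y, hy, ?_⟩
  rw [← Nat.cast_inj (R := ℕ∞), coe_rk, h2, Nat.cast_add, coe_rk, Nat.cast_one]

/-- Independence in the free product of `M` and `N`; the set `A_S` is `Sum.inl ⁻¹' A` and
the set `A_T` is `Sum.inr ⁻¹' A`. -/
def FreeProductIndep {α β : Type*} (M : Matroid α) (N : Matroid β) (A : Set (α ⊕ β)) : Prop :=
  A ⊆ Sum.inl '' M.E ∪ Sum.inr '' N.E ∧ M.Indep (Sum.inl ⁻¹' A) ∧
    N.nullity (Sum.inr ⁻¹' A) ≤ M.rankLack (Sum.inl ⁻¹' A)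

theorem ncard_sum {α β : Type*} {A : Set (α ⊕ β)} (hA : A.Finite) :
    A.ncard = (Sum.inl ⁻¹' A).ncard + (Sum.inr ⁻¹' A).ncard := by
  have h1 : (Sum.inl ⁻¹' A).Finite := hA.preimage Sum.inl_injective.injOn
  have h2 : (Sum.inr ⁻¹' A).Finite := hA.preimage Sum.inr_injective.injOn
  rw [← Set.ncard_image_of_injective _ (Sum.inl_injective (α := α) (β := β)),
    ← Set.ncard_image_of_injective (Sum.inr ⁻¹' A) (Sum.inr_injective (α := α) (β := β)),
    ← Set.ncard_union_eq ?_ (h1.image _) (h2.image _), Set.image_preimage_inl_union_image_preimage_inr]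
  rw [Set.disjoint_left]
  rintro _ ⟨x, _, rfl⟩ ⟨y, _, h⟩
  simp at h

theorem freeProduct_ground_finite {α β : Type*} (M : Matroid α) (N : Matroid β)
    [M.Finite] [N.Finite] :
    (Sum.inl '' M.E ∪ Sum.inr '' N.E : Set (α ⊕ β)).Finite :=
  (M.ground_finite.image _).union (N.ground_finite.image _)

/-- With `A_S` independent, the defining inequality reads `|A| ≤ ρ(M) + ρ_N(A_T)`. -/
theorem freeProductIndep_iff {α β : Type*} (M : Matroid α) (N : Matroid β)
    [M.Finite] [N.Finite] (A : Set (α ⊕ β)) :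
    FreeProductIndep M N A ↔ A ⊆ Sum.inl '' M.E ∪ Sum.inr '' N.E ∧ M.Indep (Sum.inl ⁻¹' A) ∧
      A.ncard ≤ M.rk M.E + N.rk (Sum.inr ⁻¹' A) := by
  unfold FreeProductIndep
  refine and_congr_right fun hA ↦ and_congr_right fun hi ↦ ?_
  have h := ncard_sum ((freeProduct_ground_finite M N).subset hA)
  unfold nullity rankLack
  rw [hi.rk_eq]
  omega

/-- The free product `M □ N` of (finite) matroids, on the disjoint union of the ground sets. -/
noncomputable def freeProduct {α β : Type*} (M : Matroid α) (N : Matroid β)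
    [M.Finite] [N.Finite] : Matroid (α ⊕ β) :=
  (IndepMatroid.ofFinite (freeProduct_ground_finite M N) (FreeProductIndep M N)
    (by
      rw [freeProductIndep_iff]
      simp)
    (by
      intro I J hJ hIJ
      have hfin := (freeProduct_ground_finite M N).subset hJ.1
      have hpl : Sum.inl ⁻¹' I ⊆ Sum.inl ⁻¹' J := Set.preimage_mono hIJ
      have hpr : Sum.inr ⁻¹' I ⊆ Sum.inr ⁻¹' J := Set.preimage_mono hIJ
      refine ⟨hIJ.trans hJ.1, hJ.2.1.subset hpl, ?_⟩
      have h3 := hJ.2.2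
      unfold nullity rankLack at *
      have h4 := M.rk_mono hpl
      have hfr : (Sum.inr ⁻¹' J).Finite := hfin.preimage Sum.inr_injective.injOn
      have h6 : (Sum.inr ⁻¹' I).ncard + (Sum.inr ⁻¹' J \ Sum.inr ⁻¹' I).ncard
          = (Sum.inr ⁻¹' J).ncard := by
        rw [add_comm, Set.ncard_sdiff_add_ncard_of_subset hpr hfr]
      have h7 : N.rk (Sum.inr ⁻¹' J) ≤ N.rk (Sum.inr ⁻¹' I)
          + (Sum.inr ⁻¹' J \ Sum.inr ⁻¹' I).ncard := by
        rw [← Nat.cast_le (α := ℕ∞), coe_rk, Nat.cast_add, coe_rk,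
          (hfr.sdiff).cast_ncard_eq]
        calc N.eRk (Sum.inr ⁻¹' J)
            = N.eRk (Sum.inr ⁻¹' I ∪ (Sum.inr ⁻¹' J \ Sum.inr ⁻¹' I)) := by
              rw [Set.union_sdiff_cancel hpr]
          _ ≤ _ := N.eRk_union_le_eRk_add_encard _ _
      omega)
    (by
      intro I J hI hJ hlt
      rw [freeProductIndep_iff] at hI hJ
      obtain ⟨hIE, hIi, hIr⟩ := hI
      obtain ⟨hJE, hJi, hJr⟩ := hJ
      have hIf := (freeProduct_ground_finite M N).subset hIE
      have hJf := (freeProduct_ground_finite M N).subset hJE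
      have hcI := ncard_sum hIf
      have hcJ := ncard_sum hJf
      have inl1 : ∀ (x : α), Sum.inl ⁻¹' (insert (Sum.inl x : α ⊕ β) I) =
          insert x (Sum.inl ⁻¹' I) := by
        intro x; ext y; simp
      have inl2 : ∀ (x : α), Sum.inr ⁻¹' (insert (Sum.inl x : α ⊕ β) I) = Sum.inr ⁻¹' I := by
        intro x; ext y; simp
      have inr1 : ∀ (x : β), Sum.inl ⁻¹' (insert (Sum.inr x : α ⊕ β) I) = Sum.inl ⁻¹' I := by
        intro x; ext y; simp
      have inr2 : ∀ (x : β), Sum.inr ⁻¹' (insert (Sum.inr x : α ⊕ β) I) =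
          insert x (Sum.inr ⁻¹' I) := by
        intro x; ext y; simp
      rcases hIr.eq_or_lt with heq | hlt2
      · obtain ⟨y, hy, hy2⟩ := N.exists_rk_insert
          (show N.rk (Sum.inr ⁻¹' I) < N.rk (Sum.inr ⁻¹' J) by omega)
        refine ⟨Sum.inr y, hy.1, hy.2, ?_⟩
        rw [freeProductIndep_iff, inr1, inr2, hy2, Set.ncard_insert_of_notMem (show Sum.inr y ∉ I from hy.2) hIf]
        exact ⟨Set.insert_subset (hJE hy.1) hIE, hIi, by omega⟩
      · by_cases hT : Sum.inr ⁻¹' J ⊆ Sum.inr ⁻¹' I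
        · have hTc := Set.ncard_le_ncard hT (hIf.preimage Sum.inr_injective.injOn)
          have hc : (Sum.inl ⁻¹' I).encard < (Sum.inl ⁻¹' J).encard := by
            rw [← (hIf.preimage Sum.inl_injective.injOn).cast_ncard_eq,
              ← (hJf.preimage Sum.inl_injective.injOn).cast_ncard_eq, Nat.cast_lt]
            omega
          obtain ⟨x, hx, hx2⟩ := hIi.exists_insert_of_encard_lt hJi hc
          refine ⟨Sum.inl x, hx.1, hx.2, ?_⟩
          rw [freeProductIndep_iff, inl1, inl2, Set.ncard_insert_of_notMem (show Sum.inl x ∉ I from hx.2) hIf]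
          exact ⟨Set.insert_subset (hJE hx.1) hIE, hx2, by omega⟩
        · obtain ⟨y, hyJ, hyI⟩ := Set.not_subset.1 hT
          refine ⟨Sum.inr y, hyJ, hyI, ?_⟩
          have hm := N.rk_mono (Set.subset_insert y (Sum.inr ⁻¹' I))
          rw [freeProductIndep_iff, inr1, inr2, Set.ncard_insert_of_notMem (show Sum.inr y ∉ I from hyI) hIf]
          exact ⟨Set.insert_subset (hJE hyJ) hIE, hIi, by omega⟩)
    (fun _ hI ↦ hI.1)).matroid

theorem freeProduct_ground {α β : Type*} (M : Matroid α) (N : Matroid β) [M.Finite] [N.Finite] :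
    (M.freeProduct N).E = Sum.inl '' M.E ∪ Sum.inr '' N.E := rfl

theorem freeProduct_indep_iff {α β : Type*} (M : Matroid α) (N : Matroid β)
    [M.Finite] [N.Finite] (A : Set (α ⊕ β)) :
    (M.freeProduct N).Indep A ↔ A ⊆ Sum.inl '' M.E ∪ Sum.inr '' N.E ∧
      M.Indep (Sum.inl ⁻¹' A) ∧ N.nullity (Sum.inr ⁻¹' A) ≤ M.rankLack (Sum.inl ⁻¹' A) :=
  Iff.rfl

/-- `M ≅ N`: there is a bijection between the ground sets under which
the independent sets of `M` and of `N` correspond. -/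
def IsIsomorphic {α β : Type*} (M : Matroid α) (N : Matroid β) : Prop :=
  ∃ e : M.E ≃ N.E, ∀ I : Set M.E, M.Indep (Subtype.val '' I) ↔ N.Indep (Subtype.val '' (e '' I))

end Matroid

namespace Matroid

open Set

/-! In `M □ N` the left ground set is a free separator (`freeProduct_isFreeSeparator`). An
isomorphism of the two products therefore yields two equicardinal free separators `S`, `U` of one
matroid `K`. A permutation exchanging `S \ U` with `U \ S` and fixing everything else is an
automorphism of `K` (`exists_perm_indep_iff`), so the isomorphism can be corrected to match left
part with left part. The factors are then read off from the product: `M` is its restriction to the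
left part, and `N` its contraction by that part. -/

/-! ### Free separators -/

/-- A set comparable under inclusion with the closure of every circuit. -/
def IsFreeSeparator {ε : Type*} (L : Matroid ε) (S : Set ε) : Prop :=
  ∀ ⦃C⦄, L.IsCircuit C → L.closure C ⊆ S ∨ S ⊆ L.closure C

/-- If `cl C` contains some `t` on the right and misses some `x` on the left, let `I` be `C` less
one element. Independence of `I + x` gives `|I| + 1 ≤ ρ(M) + ρ_N(I_T)`. Adding `t` instead costs the
same, leaves the left part alone and cannot lower the rank of the right part, so `I + t` is
independent, contrary to `t ∈ cl I`. -/
theorem freeProduct_isFreeSeparator {α β : Type*} (M : Matroid α) (N : Matroid β)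
    [M.Finite] [N.Finite] : (M.freeProduct N).IsFreeSeparator (Sum.inl '' M.E) := by
  intro C hC
  by_contra! h
  obtain ⟨h1, h2⟩ := h
  obtain ⟨y, hyC, hy⟩ := not_subset.1 h1
  obtain ⟨_, ⟨x, hxE, rfl⟩, hx⟩ := not_subset.1 h2
  have hyE : y ∈ (M.freeProduct N).E := mem_ground_of_mem_closure hyC
  obtain ⟨t, ht, rfl⟩ : ∃ t ∈ N.E, Sum.inr t = y := by
    rw [freeProduct_ground] at hyE
    exact hyE.resolve_left hy
  -- If `t` lies in `C`, it is the element to delete, so that `I + t` really has one more element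
  -- than `I`.
  obtain ⟨c, hc, htc⟩ : ∃ c ∈ C, Sum.inr t ∉ C \ {c} := by
    by_cases htC : Sum.inr t ∈ C
    · exact ⟨_, htC, by simp⟩
    · exact ⟨_, hC.nonempty.some_mem, fun h ↦ htC h.1⟩
  have hI := hC.sdiff_singleton_indep hc
  rw [← hC.closure_sdiff_singleton_eq c] at hyC hx
  generalize C \ {c} = I at *
  have hxI := hI.insert_indep_iff.2 (Or.inl ⟨Or.inl ⟨x, hxE, rfl⟩, hx⟩)
  have hxnI : Sum.inl x ∉ I := fun h ↦ hx (mem_closure_of_mem _ h hI.subset_ground)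
  refine ((hI.mem_closure_iff_of_notMem htc).1 hyC).not_indep ?_
  have hIf : I.Finite := (freeProduct_ground_finite M N).subset hI.subset_ground
  have hl : (Sum.inl ⁻¹' insert (Sum.inr t) I : Set α) = Sum.inl ⁻¹' I := by ext; simp
  have hr : (Sum.inr ⁻¹' insert (Sum.inl x) I : Set β) = Sum.inr ⁻¹' I := by ext; simp
  have hx3 := ((freeProductIndep_iff M N _).1 hxI).2.2
  have hmono := N.rk_mono (preimage_mono (f := Sum.inr) (subset_insert (Sum.inr t) I))
  rw [hr, ncard_insert_of_notMem hxnI hIf] at hx3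
  refine (freeProductIndep_iff M N _).2 ⟨insert_subset hyE hI.subset_ground, ?_, ?_⟩
  · rw [hl]
    exact ((freeProductIndep_iff M N _).1 hI).2.1
  · rw [ncard_insert_of_notMem htc hIf]
    omega

theorem IsCircuit.image_of_comap {κ ε : Type*} {L : Matroid ε} {f : κ → ε} (hf : f.Injective)
    {C : Set κ} (hC : (L.comap f).IsCircuit C) : L.IsCircuit (f '' C) := by
  rw [isCircuit_iff_dep_forall_sdiff_singleton_indep] at hC ⊢
  refine ⟨?_, ?_⟩
  · have h := comap_dep_iff.1 hC.1
    exact h.resolve_right fun h ↦ h.2 hf.injOn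
  · rintro _ ⟨x, hx, rfl⟩
    have h := (comap_indep_iff.1 (hC.2 x hx)).1
    rwa [image_sdiff hf, image_singleton] at h

theorem IsFreeSeparator.comap {κ ε : Type*} {L : Matroid ε} {S : Set ε}
    (hS : L.IsFreeSeparator S) {f : κ → ε} (hf : f.Injective) :
    (L.comap f).IsFreeSeparator (f ⁻¹' S) := by
  intro C hC
  rw [comap_closure_eq]
  exact (hS (hC.image_of_comap hf)).imp (preimage_mono ·) (preimage_mono ·)

/-! ### Exchanging two free separators of equal size -/

theorem exists_perm_exchanging {κ : Type*} [Finite κ] {S U : Set κ} (h : S.ncard = U.ncard) :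
    ∃ σ : Equiv.Perm κ, (∀ x, σ x ∈ U ↔ x ∈ S) ∧ ∀ x, (x ∈ S ↔ x ∈ U) → σ x = x := by
  classical
  have hcard : (S \ U).ncard = (U \ S).ncard := (ncard_eq_ncard_iff_ncard_sdiff_eq_ncard_sdiff).1 h
  -- Inside the symmetric difference, `U \ S` is the complement of `S \ U`, so any extension of a
  -- bijection `S \ U ≃ U \ S` sends `U \ S` back onto `S \ U`.
  let p : κ → Prop := fun x ↦ ¬ (x ∈ S ↔ x ∈ U)
  have hc (A B : Set κ) (hAB : ∀ x, x ∈ A \ B → p x) :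
      Nat.card {w : Subtype p // w.1 ∈ A \ B} = (A \ B).ncard := by
    rw [← Nat.card_coe_set_eq]
    exact Nat.card_congr ⟨fun w ↦ ⟨w.1.1, w.2⟩, fun w ↦ ⟨⟨w.1, hAB _ w.2⟩, w.2⟩,
      fun _ ↦ rfl, fun _ ↦ rfl⟩
  obtain ⟨e⟩ : Nonempty ({w : Subtype p // w.1 ∈ S \ U} ≃ {w : Subtype p // w.1 ∈ U \ S}) := by
    refine (Finite.card_eq).1 ?_
    rw [hc S U (fun x hx ↦ by simp only [p]; tauto_set),
      hc U S (fun x hx ↦ by simp only [p]; tauto_set), hcard]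
  refine ⟨Equiv.Perm.ofSubtype e.extendSubtype, fun x ↦ ?_, fun x hx ↦
    Equiv.Perm.ofSubtype_apply_of_not_mem _ (not_not.2 hx)⟩
  by_cases hx : p x
  · rw [Equiv.Perm.ofSubtype_apply_of_mem _ hx]
    have h1 := e.extendSubtype_mem ⟨x, hx⟩
    have h2 := e.extendSubtype_not_mem ⟨x, hx⟩
    have h3 := (e.extendSubtype ⟨x, hx⟩).2
    simp only [p, mem_sdiff] at h1 h2 h3 hx
    generalize (e.extendSubtype ⟨x, hx⟩ : κ) = y at h1 h2 h3 ⊢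
    by_cases hxS : x ∈ S <;> by_cases hxU : x ∈ U <;> simp only [hxS, hxU] at * <;> tauto
  · rw [Equiv.Perm.ofSubtype_apply_of_not_mem _ hx]
    exact (not_not.1 hx).symm

/-- Let `C ⊆ σ '' I` be a circuit. If `σ` moves a point into `C`, then `cl C` meets the symmetric
difference of `S` and `U`, which by comparability and equal size forces `S ∪ U ⊆ cl C`. Hence always
`σ ⁻¹' C ⊆ cl C`, but an independent set of size `|C|` cannot fit in a flat of rank below `|C|`. -/
theorem Indep.image_of_isFreeSeparator {κ : Type*} [Finite κ] {K : Matroid κ} (hE : K.E = univ)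
    {S U : Set κ} (hS : K.IsFreeSeparator S) (hU : K.IsFreeSeparator U) (h : S.ncard = U.ncard)
    (σ : Equiv.Perm κ) (hσ : ∀ x, (x ∈ S ↔ x ∈ U) → σ x = x) {I : Set κ} (hI : K.Indep I) :
    K.Indep (σ '' I) := by
  by_contra hcon
  obtain ⟨C, hCI, hC⟩ := ((not_indep_iff (by simp [hE])).1 hcon).exists_isCircuit_subset
  have hσ' : ∀ x, ¬ (x ∈ S ↔ x ∈ U) → ¬ (σ x ∈ S ↔ σ x ∈ U) := fun x hx h ↦
    hx (by rwa [σ.injective (hσ _ h)] at h)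
  have hF : σ ⁻¹' C ⊆ K.closure C := by
    intro x hx
    have hx' : σ x ∈ K.closure C := mem_closure_of_mem _ hx hC.subset_ground
    by_cases hxSU : x ∈ S ↔ x ∈ U
    · rwa [hσ x hxSU] at hx'
    have hxSU' := hσ' x hxSU
    rcases hS hC with h1 | h1 <;> rcases hU hC with h2 | h2
    · exact (hxSU' ⟨fun _ ↦ h2 hx', fun _ ↦ h1 hx'⟩).elim
    -- Here `U ⊆ cl C ⊆ S`, so equal size gives `S = U` and the symmetric difference is empty.
    · rw [eq_of_subset_of_ncard_le (h2.trans h1) h.le] at hxSU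
      exact (hxSU Iff.rfl).elim
    · rw [eq_of_subset_of_ncard_le (h1.trans h2) h.ge] at hxSU
      exact (hxSU Iff.rfl).elim
    · by_contra hx2
      exact hxSU ⟨fun hx3 ↦ (hx2 (h1 hx3)).elim, fun hx3 ↦ (hx2 (h2 hx3)).elim⟩
  have hind : K.Indep (σ ⁻¹' C) := hI.subset fun x hx ↦ by
    obtain ⟨y, hy, hyx⟩ := hCI hx
    rwa [← σ.injective hyx]
  have hle := K.eRk_mono hF
  rw [eRk_closure_eq, hind.eRk_eq_encard, ← Equiv.image_symm_eq_preimage,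
    σ.symm.injective.encard_image] at hle
  exact hle.not_gt (eRk_lt_encard_of_dep_of_finite (toFinite C) hC.dep)

theorem exists_perm_indep_iff {κ : Type*} [Finite κ] {K : Matroid κ} (hE : K.E = univ)
    {S U : Set κ} (hS : K.IsFreeSeparator S) (hU : K.IsFreeSeparator U) (h : S.ncard = U.ncard) :
    ∃ σ : Equiv.Perm κ, (∀ x, σ x ∈ U ↔ x ∈ S) ∧ ∀ I, K.Indep (σ '' I) ↔ K.Indep I := by
  obtain ⟨σ, hσ, hfix⟩ := exists_perm_exchanging h
  refine ⟨σ, hσ, fun I ↦ ⟨fun hI ↦ ?_, .image_of_isFreeSeparator hE hS hU h σ hfix⟩⟩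
  have h2 := hI.image_of_isFreeSeparator hE hS hU h σ.symm
    (fun x hx ↦ by rw [Equiv.symm_apply_eq, hfix x hx])
  rwa [← image_comp, Equiv.symm_comp_self, image_id] at h2

/-! ### Recovering the factors -/

theorem isIsomorphic_of_parametrizations {κ α γ : Type*} {M : Matroid α} {P : Matroid γ}
    {a : κ → α} {b : κ → γ} (ha : a.Injective) (hb : b.Injective) (hM : range a = M.E)
    (hP : range b = P.E) (h : ∀ I : Set κ, M.Indep (a '' I) ↔ P.Indep (b '' I)) :
    M.IsIsomorphic P := by
  let ea : κ ≃ M.E := (Equiv.ofInjective a ha).trans (Equiv.setCongr hM)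
  let eb : κ ≃ P.E := (Equiv.ofInjective b hb).trans (Equiv.setCongr hP)
  refine ⟨ea.symm.trans eb, fun I ↦ ?_⟩
  obtain ⟨J, rfl⟩ : ∃ J, I = ea '' J := ⟨ea.symm '' I, by simp⟩
  have h1 : Subtype.val '' (ea '' J) = a '' J := by
    rw [← image_comp]; rfl
  have h2 : Subtype.val '' ((ea.symm.trans eb) '' (ea '' J)) = b '' J := by
    rw [← image_comp, ← image_comp]
    refine image_congr fun x _ ↦ ?_
    simp [eb]
  rw [h1, h2, h]

theorem freeProduct_indep_inl_image {α β : Type*} (M : Matroid α) (N : Matroid β)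
    [M.Finite] [N.Finite] {I : Set α} :
    (M.freeProduct N).Indep (Sum.inl '' I) ↔ M.Indep I := by
  have hl : (Sum.inl ⁻¹' (Sum.inl '' I : Set (α ⊕ β))) = I := preimage_image_eq _ Sum.inl_injective
  have hr : (Sum.inr ⁻¹' (Sum.inl '' I : Set (α ⊕ β))) = ∅ := by ext; simp
  rw [freeProduct_indep_iff, hl, hr]
  refine ⟨fun h ↦ h.2.1, fun h ↦ ⟨(image_mono h.subset_ground).trans subset_union_left, h, ?_⟩⟩
  have := M.rk_mono h.subset_ground
  simp only [nullity, rankLack, ncard_empty]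
  omega

theorem Indep.nullity_eq_zero {α : Type*} {M : Matroid α} {I : Set α} (hI : M.Indep I) :
    M.nullity I = 0 := by
  rw [nullity, hI.rk_eq, sub_self]

theorem indep_of_nullity_nonpos {α : Type*} (M : Matroid α) [M.Finite] {A : Set α}
    (hA : A ⊆ M.E) (h : M.nullity A ≤ 0) : M.Indep A := by
  rw [indep_iff_eRk_eq_encard_of_finite (M.ground_finite.subset hA)]
  refine (M.eRk_le_encard A).antisymm ?_
  rw [← coe_rk, ← (M.ground_finite.subset hA).cast_ncard_eq, Nat.cast_le]
  simpa [nullity] using h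

/-- This describes `N` as a contraction, using only the product and its left part, so it transfers
along isomorphisms that respect left parts. -/
theorem indep_iff_forall_freeProduct_indep {α β : Type*} (M : Matroid α) (N : Matroid β)
    [M.Finite] [N.Finite] {J : Set β} :
    N.Indep J ↔ ∀ I ⊆ M.E, (M.freeProduct N).Indep (Sum.inl '' I) →
      (M.freeProduct N).Indep (Sum.inl '' I ∪ Sum.inr '' J) := by
  have hl (I : Set α) : (Sum.inl ⁻¹' (Sum.inl '' I ∪ Sum.inr '' J : Set (α ⊕ β))) = I := by
    ext; simp
  have hr (I : Set α) : (Sum.inr ⁻¹' (Sum.inl '' I ∪ Sum.inr '' J : Set (α ⊕ β))) = J := by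
    ext; simp
  refine ⟨fun hJ I hIE hI ↦ ?_, fun h ↦ ?_⟩
  · rw [freeProduct_indep_inl_image] at hI
    rw [freeProduct_indep_iff, hl, hr, hJ.nullity_eq_zero, rankLack, sub_nonneg, Nat.cast_le]
    exact ⟨union_subset_union (image_mono hIE) (image_mono hJ.subset_ground), hI, M.rk_mono hIE⟩
  -- A base has rank-lack zero, which leaves no room for positive nullity of `J`.
  · obtain ⟨B, hB⟩ := M.exists_isBase
    have h' := h B hB.subset_ground ((freeProduct_indep_inl_image M N).2 hB.indep)
    rw [freeProduct_indep_iff, hl, hr] at h'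
    refine N.indep_of_nullity_nonpos (fun y hy ↦ ?_) (h'.2.2.trans_eq ?_)
    · simpa using h'.1 (Or.inr ⟨y, hy, rfl⟩)
    · rw [rankLack, rk, rk, hB.eRk_eq_eRank, eRk_ground, sub_self]

theorem isIsomorphic_of_freeProduct_parametrizations {κ α β γ δ : Type*}
    (M : Matroid α) (N : Matroid β) (P : Matroid γ) (Q : Matroid δ)
    [M.Finite] [N.Finite] [P.Finite] [Q.Finite] {f : κ → α ⊕ β} {g : κ → γ ⊕ δ}
    (hf : f.Injective) (hg : g.Injective) (hfE : range f = (M.freeProduct N).E)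
    (hgE : range g = (P.freeProduct Q).E)
    (hind : ∀ I, (M.freeProduct N).Indep (f '' I) ↔ (P.freeProduct Q).Indep (g '' I))
    (hS : ∀ x, f x ∈ Sum.inl '' M.E ↔ g x ∈ Sum.inl '' P.E) :
    M.IsIsomorphic P ∧ N.IsIsomorphic Q := by
  have hT x : f x ∈ Sum.inr '' N.E ↔ g x ∈ Sum.inr '' Q.E := by
    have h1 : f x ∈ Sum.inl '' M.E ∪ Sum.inr '' N.E :=
      hfE.subset (mem_range_self x)
    have h2 : g x ∈ Sum.inl '' P.E ∪ Sum.inr '' Q.E :=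
      hgE.subset (mem_range_self x)
    have h3 := hS x
    rcases h1 with ⟨u, hu, hu'⟩ | ⟨u, hu, hu'⟩ <;> rcases h2 with ⟨v, hv, hv'⟩ | ⟨v, hv, hv'⟩ <;>
      simp [← hu', ← hv', hu, hv] at h3 ⊢
  let S := {x // f x ∈ Sum.inl '' M.E}
  let T := {x // f x ∈ Sum.inr '' N.E}
  choose a haE ha using fun x : S ↦ x.2
  choose c hcE hc using fun x : S ↦ (hS x.1).1 x.2
  choose b hbE hb using fun x : T ↦ x.2
  choose d hdE hd using fun x : T ↦ (hT x.1).1 x.2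
  have haR : range a = M.E := by
    refine (range_subset_iff.2 haE).antisymm fun y hy ↦ ?_
    obtain ⟨x, hx⟩ : Sum.inl y ∈ range f := hfE ▸ Or.inl ⟨y, hy, rfl⟩
    exact ⟨⟨x, y, hy, hx.symm⟩, Sum.inl_injective (by rw [ha, hx])⟩
  have hcR : range c = P.E := by
    refine (range_subset_iff.2 hcE).antisymm fun y hy ↦ ?_
    obtain ⟨x, hx⟩ : Sum.inl y ∈ range g := hgE ▸ Or.inl ⟨y, hy, rfl⟩
    exact ⟨⟨x, (hS x).2 ⟨y, hy, hx.symm⟩⟩, Sum.inl_injective (by rw [hc, hx])⟩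
  have hbR : range b = N.E := by
    refine (range_subset_iff.2 hbE).antisymm fun y hy ↦ ?_
    obtain ⟨x, hx⟩ : Sum.inr y ∈ range f := hfE ▸ Or.inr ⟨y, hy, rfl⟩
    exact ⟨⟨x, y, hy, hx.symm⟩, Sum.inr_injective (by rw [hb, hx])⟩
  have hdR : range d = Q.E := by
    refine (range_subset_iff.2 hdE).antisymm fun y hy ↦ ?_
    obtain ⟨x, hx⟩ : Sum.inr y ∈ range g := hgE ▸ Or.inr ⟨y, hy, rfl⟩
    exact ⟨⟨x, (hT x).2 ⟨y, hy, hx.symm⟩⟩, Sum.inr_injective (by rw [hd, hx])⟩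
  have hai (I : Set S) : Sum.inl '' (a '' I) = f '' (Subtype.val '' I) := by
    simp only [image_image, ha]; rfl
  have hci (I : Set S) : Sum.inl '' (c '' I) = g '' (Subtype.val '' I) := by
    simp only [image_image, hc]; rfl
  have hbi (I : Set T) : Sum.inr '' (b '' I) = f '' (Subtype.val '' I) := by
    simp only [image_image, hb]; rfl
  have hdi (I : Set T) : Sum.inr '' (d '' I) = g '' (Subtype.val '' I) := by
    simp only [image_image, hd]; rfl
  refine ⟨isIsomorphic_of_parametrizations (a := a) (b := c) ?_ ?_ haR hcR fun I ↦ ?_,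
    isIsomorphic_of_parametrizations (a := b) (b := d) ?_ ?_ hbR hdR fun J ↦ ?_⟩
  · exact fun x y h ↦ Subtype.ext (hf (by rw [← ha, ← ha, h]))
  · exact fun x y h ↦ Subtype.ext (hg (by rw [← hc, ← hc, h]))
  · rw [← freeProduct_indep_inl_image M N, ← freeProduct_indep_inl_image P Q, hai, hci, hind]
  · exact fun x y h ↦ Subtype.ext (hf (by rw [← hb, ← hb, h]))
  · exact fun x y h ↦ Subtype.ext (hg (by rw [← hd, ← hd, h]))
  · rw [indep_iff_forall_freeProduct_indep M N, indep_iff_forall_freeProduct_indep P Q,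
      ← haR, ← hcR, forall_subset_range_iff, forall_subset_range_iff]
    simp only [hai, hbi, hci, hdi, ← image_union, hind]

end Matroid

/-! ### Unique factorization -/

theorem mainTheorem11 {α β γ δ : Type*}
    (M : Matroid α) (N : Matroid β) (P : Matroid γ) (Q : Matroid δ)
    [M.Finite] [N.Finite] [P.Finite] [Q.Finite]
    (hiso : (M.freeProduct N).IsIsomorphic (P.freeProduct Q))
    (hcard : M.E.ncard = P.E.ncard) :
    M.IsIsomorphic P ∧ N.IsIsomorphic Q := by
  obtain ⟨e, he⟩ := hiso
  have : Finite (M.freeProduct N).E := (Matroid.freeProduct_ground_finite M N).to_subtype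
  let f : (M.freeProduct N).E → α ⊕ β := Subtype.val
  let g : (M.freeProduct N).E → γ ⊕ δ := fun x ↦ (e x).1
  have hf : f.Injective := Subtype.val_injective
  have hg : g.Injective := Subtype.val_injective.comp e.injective
  have hfE : Set.range f = (M.freeProduct N).E := Subtype.range_val
  have hgE : Set.range g = (P.freeProduct Q).E := by
    rw [show g = Subtype.val ∘ e from rfl, e.surjective.range_comp, Subtype.range_val]
  have hfg I : (M.freeProduct N).Indep (f '' I) ↔ (P.freeProduct Q).Indep (g '' I) := by
    rw [he, Set.image_image]
  have hfu : f ⁻¹' (M.freeProduct N).E = Set.univ := Subtype.coe_preimage_self _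
  -- Both products pull back to one matroid, in which the two left parts can be compared.
  have hK : (M.freeProduct N).comap f = (P.freeProduct Q).comap g := by
    refine Matroid.ext_indep ?_ fun I _ ↦ ?_
    · rw [Matroid.comap_ground_eq, Matroid.comap_ground_eq, hfu, ← hgE, Set.preimage_range]
    · rw [Matroid.comap_indep_iff_of_injOn hf.injOn, Matroid.comap_indep_iff_of_injOn hg.injOn, hfg]
  have hU := (P.freeProduct_isFreeSeparator Q).comap hg
  rw [← hK] at hU
  obtain ⟨σ, hσ, hσi⟩ := Matroid.exists_perm_indep_iff
    hfu
    ((M.freeProduct_isFreeSeparator N).comap hf) hU (by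
      rw [Set.ncard_preimage_of_injective_subset_range hf
          (by rw [hfE]; exact Set.subset_union_left),
        Set.ncard_preimage_of_injective_subset_range hg
          (by rw [hgE]; exact Set.subset_union_left),
        Set.ncard_image_of_injective _ Sum.inl_injective,
        Set.ncard_image_of_injective _ Sum.inl_injective, hcard])
  -- Precomposing with `σ` turns the given isomorphism into one that respects the left parts.
  refine Matroid.isIsomorphic_of_freeProduct_parametrizations M N P Q (g := g ∘ σ) hf
    (hg.comp σ.injective) hfE (by rw [σ.surjective.range_comp, hgE]) (fun I ↦ ?_)
    fun x ↦ (hσ x).symm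
  rw [Set.image_comp, ← hfg, ← Matroid.comap_indep_iff_of_injOn hf.injOn,
    ← Matroid.comap_indep_iff_of_injOn hf.injOn, hσi]
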